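/- Let $(X,d)$ be a complete separable geodesic metric space, write $|xy|=d(x,y)$, and let $S\ge 1$, $C\ge 0$, $D>0$. A constant-speed geodesic is a map $\xi:[0,1]\to X$ with $|\xi(s)\xi(t)|=|s-t|\,|\xi(0)\xi(1)|$. Assume that $X$ is * *$S$-concave*: $|p\xi(t)|^2\ge(1-t)|p\xi(0)|^2+t|p\xi(1)|^2-S\,t(1-t)|\xi(0)\xi(1)|^2$ for all $p\in X$, all constant-speed geodesics $\xi$ and all $t\in[0,1]$; * *$(C,D)$-locally semi-convex*: $|p\xi(t)|^2\le(1-t)|p\xi(0)|^2+t|p\xi(1)|^2+C\,t(1-t)|\xi(0)\xi(1)|^2$ for all $t\in[0,1]$, whenever $\sup_t|p\xi(t)|<D$; * *Busemann concave*: $t\mapsto|\gamma(t)\eta(t)|/t$ is non-increasing on $(0,1]$ for all constant-speed geodesics $\gamma,\eta$ with $\gamma(0)=\eta(0)$. Let $\tilde\angle pxq$ be the Euclidean comparison angle at $x$. For $\delta>0$ call $p\neq x$ a *$(1,\delta)$-strainer at $x$ with opposite strainer $q\ne x$* if $\tilde\angle pxq>\pi-\delta$ and $\arccos\bigl(1-S\tfrac{|qx|}{2|px|}\bigr)<\delta$.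 For $R>0$, a tuple $(p_1,\dots,p_k)$ is a *$(k,\delta)$-strainer at $x$ (of radius $R$)* if $|p_1x|<R$ and for each $j$: $\arccos\bigl(1-(S+C)\tfrac{|p_jx|}{2|p_ix|}\bigr)<\delta$ for all $i<j$, and $p_j$ is a $(1,\delta)$-strainer at $x$ with some opposite strainer $q_j$ such that $|\tilde\angle p_ixp_j-\pi/2|<\delta$ and $|\tilde\angle p_ixq_j-\pi/2|<\delta$ for all $i<j$ (the empty tuple is a $(0,\delta)$-strainer). Let $\mathcal A_R(k,\delta)$ be the set of points that admit a $(k,\delta)$-strainer of radius $R$. The strainer number (of radius $R$) at $x$ is the $m$ such that for all sufficiently small $\delta$ every neighbourhood of $x$ meets $\mathcal A_R(m,\delta)$, while this fails for $m+1$ (it is $\infty$ if there is no such $m$); the strainer number of $X$ is the supremum over $x\in X$. Put $\delta_k=k^{-1}2^{-2k-1}$. Assume that $X$ is *$n$-dimensional*: its Hausdorff dimension is $n$, or its strainer number of radius $R$ is $n$ for some $R\in(0,D)$. Then: 1. For all $0<R\le D$ and all $\delta>0$, the set $\mathcal A_R(n,\delta)$ is open and dense in $X$. 2. If $R>0$,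 $0<\delta<\delta_{n+1}/2$ and $(1+\delta^2)R\le D$, then $\mathcal A_R(n,\delta)$ is a topological $n$-manifold. Moreover, for every $x\in X$ and every $(n,\delta)$-strainer $(p_1,\dots,p_n)$ of radius $R$ at $x$ there is an open neighbourhood $V\subset\mathcal A_R(n,\delta)$ of $x$ such that $(p_1,\dots,p_n)$ is an $(n,\delta)$-strainer at every point of $V$ and the strainer map $y\mapsto(|p_1y|,\dots,|p_ny|)$ is a bi-Lipschitz homeomorphism of $V$ onto an open subset of $\mathbb R^n$. -/

import Mathlib

open Set Topology

namespace BusemannConcave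

/-- `γ`, restricted to `[0,1]`, is a constant-speed (length-minimizing) geodesic from `γ 0` to
`γ 1`. Only the values of `γ` on `[0,1]` matter. -/
def IsConstSpeedGeodesic {X : Type*} [MetricSpace X] (γ : ℝ → X) : Prop :=
  ∀ s ∈ Icc (0 : ℝ) 1, ∀ t ∈ Icc (0 : ℝ) 1, dist (γ s) (γ t) = |s - t| * dist (γ 0) (γ 1)

/-- Any two points are joined by a geodesic. -/
def IsGeodesicSpace (X : Type*) [MetricSpace X] : Prop :=
  ∀ x y : X, ∃ γ : ℝ → X, IsConstSpeedGeodesic γ ∧ γ 0 = x ∧ γ 1 = y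

/-- `S`-concavity: the squared distance from any point is `S`-concave along geodesics. -/
def IsSConcave (X : Type*) [MetricSpace X] (S : ℝ) : Prop :=
  ∀ (p : X) (ξ : ℝ → X), IsConstSpeedGeodesic ξ → ∀ t ∈ Icc (0 : ℝ) 1,
    (1 - t) * dist p (ξ 0) ^ 2 + t * dist p (ξ 1) ^ 2 - S * t * (1 - t) * dist (ξ 0) (ξ 1) ^ 2
      ≤ dist p (ξ t) ^ 2

/-- `(C, D)`-local semi-convexity. As `ξ` is continuous on the compact interval `[0,1]`, the
requirement `sup_t |p ξ(t)| < D` says that `|p ξ(t)| < D` for each `t`. -/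
def IsLocallySemiConvex (X : Type*) [MetricSpace X] (C D : ℝ) : Prop :=
  ∀ (p : X) (ξ : ℝ → X), IsConstSpeedGeodesic ξ → (∀ t ∈ Icc (0 : ℝ) 1, dist p (ξ t) < D) →
    ∀ t ∈ Icc (0 : ℝ) 1,
      dist p (ξ t) ^ 2 ≤ (1 - t) * dist p (ξ 0) ^ 2 + t * dist p (ξ 1) ^ 2
        + C * t * (1 - t) * dist (ξ 0) (ξ 1) ^ 2

/-- Busemann concavity: for geodesics `γ, η` from a common point, `t ↦ |γ(t) η(t)| / t` is
non-increasing. -/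
def IsBusemannConcave (X : Type*) [MetricSpace X] : Prop :=
  ∀ γ η : ℝ → X, IsConstSpeedGeodesic γ → IsConstSpeedGeodesic η → γ 0 = η 0 →
    AntitoneOn (fun t : ℝ => dist (γ t) (η t) / t) (Ioc (0 : ℝ) 1)

/-- The comparison angle at `x`: the angle at the vertex corresponding to `x` in the Euclidean
triangle with side lengths `|px|`, `|xq|`, `|pq|`. It is only used for `p ≠ x` and `q ≠ x`. -/
noncomputable def compAngle {X : Type*} [MetricSpace X] (p x q : X) : ℝ :=
  Real.arccos ((dist p x ^ 2 + dist q x ^ 2 - dist p q ^ 2) / (2 * dist p x * dist q x))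

/-- `p` is a `(1, δ)`-strainer at `x` with opposite strainer `q`. -/
def IsStrainerPair {X : Type*} [MetricSpace X] (S δ : ℝ) (p q x : X) : Prop :=
  p ≠ x ∧ q ≠ x ∧ Real.pi - δ < compAngle p x q ∧
    Real.arccos (1 - S * dist q x / (2 * dist p x)) < δ

/-- `(p 0, …, p (k-1))` is a `(k, δ)`-strainer at `x`, with respect to the constants `S`, `C`
and the radius `D`. The induction on `k` is written out: the `j`-th entry has to satisfy its
conditions with respect to all entries of lower index. The empty tuple is a `(0, δ)`-strainer. -/
def IsStrainer {X : Type*} [MetricSpace X] (S C D δ : ℝ) {k : ℕ} (p : Fin k → X) (x : X) : Prop :=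
  (∀ h : 0 < k, dist (p ⟨0, h⟩) x < D) ∧
  ∀ j : Fin k,
    (∀ i < j, Real.arccos (1 - (S + C) * dist (p j) x / (2 * dist (p i) x)) < δ) ∧
    ∃ q : X, IsStrainerPair S δ (p j) q x ∧
      ∀ i < j, |compAngle (p i) x (p j) - Real.pi / 2| < δ ∧
        |compAngle (p i) x q - Real.pi / 2| < δ

/-- The set `𝒜(k, δ)` of `(k, δ)`-strained points. -/
def strainedSet (X : Type*) [MetricSpace X] (S C D : ℝ) (k : ℕ) (δ : ℝ) : Set X :=
  {x | ∃ p : Fin k → X, IsStrainer S C D δ p x}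

/-- The map `(d_{p 0}, …, d_{p (k-1)})` of distances from the points of a tuple. -/
noncomputable def strainerMap {X : Type*} [MetricSpace X] {k : ℕ} (p : Fin k → X) (x : X) :
    EuclideanSpace ℝ (Fin k) :=
  WithLp.toLp 2 fun i => dist (p i) x

/-- For every sufficiently small `δ`, every neighbourhood of `x` contains an
`(m, δ)`-strained point. -/
def StrainedNear {X : Type*} [MetricSpace X] (S C D : ℝ) (m : ℕ) (x : X) : Prop :=
  ∀ᶠ δ in 𝓝[>] (0 : ℝ), ∀ U ∈ 𝓝 x, ∃ y ∈ U, y ∈ strainedSet X S C D m δ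

/-- The strainer number at `x`: the number `m` such that `StrainedNear` holds for `m` and fails
for `m + 1`. If there is none, the infimum is over the empty set and the value is `⊤`. -/
noncomputable def strainerNumberAt {X : Type*} [MetricSpace X] (S C D : ℝ) (x : X) : ℕ∞ :=
  ⨅ m ∈ {m : ℕ | StrainedNear S C D m x ∧ ¬ StrainedNear S C D (m + 1) x}, (m : ℕ∞)

/-- The strainer number of the space. -/
noncomputable def strainerNumber (X : Type*) [MetricSpace X] (S C D : ℝ) : ℕ∞ :=
  ⨆ x : X, strainerNumberAt S C D x

/-- The constant `δ_k = k⁻¹ 2^{-2k-1}`. -/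
noncomputable def strainerConst (k : ℕ) : ℝ := 1 / (k * 2 ^ (2 * k + 1))

/-- `f` restricted to `V` is bi-Lipschitz. -/
def IsBiLipschitzOn {X Y : Type*} [MetricSpace X] [MetricSpace Y] (f : X → Y) (V : Set X) : Prop :=
  ∃ L : ℝ, 1 ≤ L ∧ ∀ y ∈ V, ∀ z ∈ V,
    dist y z / L ≤ dist (f y) (f z) ∧ dist (f y) (f z) ≤ L * dist y z

/-- A topological `n`-manifold (without boundary): Hausdorff, second countable, and locally
homeomorphic to open subsets of `ℝⁿ`. -/
def IsTopologicalManifold (n : ℕ) (M : Type*) [TopologicalSpace M] : Prop :=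
  T2Space M ∧ SecondCountableTopology M ∧ Nonempty (ChartedSpace (EuclideanSpace ℝ (Fin n)) M)

end BusemannConcave

namespace BusemannConcave

/-! Strainer maps behave like coordinates for two reasons.

They are open. At a strained point one can move towards `p j` or its opposite strainer: the `j`-th
distance then changes at almost unit speed, earlier distances change at rate at most `2δ`, and later
ones at rate at most `1` (`IsStrainer.exists_step`). Coordinate errors weighted by `2⁻ⁱ` therefore
decrease at rate `3δ` as long as some error is nonzero (`sum_half_pow_mul_le`), and Ekeland's
principle produces an exact solution. Hence a `k`-strainer forces Hausdorff dimension at least `k`.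

They separate points unless the strainer extends. If nearby `y`, `z` have almost equal distances to
all `p i`, the geodesic `yz` is almost perpendicular to every `p i`, so at its midpoint `y` is a
further strainer (`IsStrainer.exists_extension`). Where no extension exists, the map is bi-Lipschitz
and the local dimension is at most `k`.

By Busemann concavity all nonempty open sets have the same dimension, so a locally maximal strainer
has length `dimH univ` (`IsStrainer.dimH_eq`). This identifies the two notions of dimension and
gives density and the charts. -/

/-! ### From comparison angles to inequalities. -/

theorem cos_lt_of_arccos_lt {u δ : ℝ} (hδ : 0 < δ) (hδ1 : δ ≤ 1) (h : Real.arccos u < δ) :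
    Real.cos δ < u := by
  by_contra hu
  -- Monotonicity of the extended `arccos` is enough, so `u` need not lie in `[-1, 1]`.
  have h1 := Real.antitone_arccos (not_lt.1 hu)
  rw [Real.arccos_cos hδ.le (by linarith [Real.pi_gt_three])] at h1
  linarith

theorem lt_neg_cos_of_lt_arccos {u δ : ℝ} (hδ : 0 < δ) (hδ1 : δ ≤ 1)
    (h : Real.pi - δ < Real.arccos u) : u < -Real.cos δ := by
  have := Real.arccos_neg u
  have := cos_lt_of_arccos_lt (u := -u) hδ hδ1 (by linarith)
  linarith

theorem abs_lt_of_abs_arccos_sub_lt {u δ : ℝ} (hδ : 0 < δ) (hδ1 : δ ≤ 1)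
    (h : |Real.arccos u - Real.pi / 2| < δ) : |u| < δ := by
  have hs : Real.sin δ ≤ δ := Real.sin_le hδ.le
  have hpi := Real.pi_gt_three
  have key : ∀ v : ℝ, Real.arcsin v < δ → v < Real.sin δ := by
    intro v hv
    by_contra hc
    have h1 := Real.monotone_arcsin (not_lt.1 hc)
    rw [Real.arcsin_sin (by linarith) (by linarith)] at h1
    linarith
  have e := Real.arccos_eq_pi_div_two_sub_arcsin u
  rw [e, abs_lt] at h
  have h1 := key u (by linarith [h.1])
  have h2 := key (-u) (by rw [Real.arcsin_neg]; linarith [h.2])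
  rw [abs_lt]
  constructor <;> linarith

/-- A ratio whose "angle" is less than `δ` is bounded by `δ ^ 2`. -/
theorem mul_lt_of_arccos_one_sub_lt {K a b δ : ℝ} (hb : 0 < b) (hδ : 0 < δ)
    (hδ1 : δ ≤ 1) (h : Real.arccos (1 - K * a / (2 * b)) < δ) : K * a < b * δ ^ 2 := by
  have h1 := cos_lt_of_arccos_lt hδ hδ1 h
  have h2 := Real.one_sub_sq_div_two_le_cos (x := δ)
  have h3 : K * a / (2 * b) < δ ^ 2 / 2 := by linarith
  rw [div_lt_iff₀ (by positivity)] at h3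
  nlinarith

/-! ### Distance functions along short geodesics. -/

variable {X : Type*} [MetricSpace X]

theorem IsConstSpeedGeodesic.dist_left {ξ : ℝ → X} (hξ : IsConstSpeedGeodesic ξ) {t : ℝ}
    (ht : t ∈ Icc (0 : ℝ) 1) : dist (ξ 0) (ξ t) = t * dist (ξ 0) (ξ 1) := by
  rw [hξ 0 (by simp) t ht, zero_sub, abs_neg, abs_of_nonneg ht.1]

theorem IsConstSpeedGeodesic.dist_right {ξ : ℝ → X} (hξ : IsConstSpeedGeodesic ξ) {t : ℝ}
    (ht : t ∈ Icc (0 : ℝ) 1) : dist (ξ t) (ξ 1) = (1 - t) * dist (ξ 0) (ξ 1) := by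
  rw [hξ t ht 1 (by simp), abs_sub_comm, abs_of_nonneg (by linarith [ht.2])]

/-- Along a short geodesic making an almost right comparison angle with `p`, the distance from `p`
is almost constant. -/
theorem abs_dist_sub_le_of_compAngle {S C D δ : ℝ} (hS : 1 ≤ S) (hC : 0 ≤ C)
    (hconc : IsSConcave X S) (hconv : IsLocallySemiConvex X C D) (hδ : 0 < δ)
    (hδ1 : δ ≤ 1 / 16) {p : X} {ξ : ℝ → X} (hξ : IsConstSpeedGeodesic ξ) (hp : p ≠ ξ 0)
    (hne : ξ 0 ≠ ξ 1) (hang : |compAngle p (ξ 0) (ξ 1) - Real.pi / 2| < δ)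
    (hL : (S + C) * dist (ξ 0) (ξ 1) < dist p (ξ 0) * δ ^ 2)
    (hD : (1 + δ ^ 2) * dist p (ξ 0) < D) {t : ℝ} (ht : t ∈ Icc (0 : ℝ) 1) :
    |dist p (ξ t) - dist p (ξ 0)| ≤ 2 * δ * dist (ξ 0) (ξ t) := by
  have hd : 0 < dist p (ξ 0) := dist_pos.2 hp
  have hl : 0 < dist (ξ 0) (ξ 1) := dist_pos.2 hne
  have hc := abs_lt_of_abs_arccos_sub_lt hδ (by linarith) hang
  rw [dist_comm (ξ 1) (ξ 0)] at hc
  -- The geodesic is shorter than `d δ²`, so it stays within distance `(1 + δ²) d < D` of `p`, where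
  -- semi-convexity is available.
  have hlt : ∀ s ∈ Icc (0 : ℝ) 1, dist p (ξ s) < D := by
    intro s hs
    have h1 := dist_triangle p (ξ 0) (ξ s)
    rw [hξ.dist_left hs] at h1
    nlinarith [hs.1, hs.2]
  have lo := hconc p ξ hξ t ht
  have up := hconv p ξ hξ hlt t ht
  rw [hξ.dist_left ht]
  have hf : 0 ≤ dist p (ξ t) := dist_nonneg
  set d := dist p (ξ 0)
  set l := dist (ξ 0) (ξ 1)
  set e := dist p (ξ 1)
  set f := dist p (ξ t)
  obtain ⟨ht0, ht1⟩ := ht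
  rw [abs_div, abs_of_pos (show 0 < 2 * d * l by positivity), div_lt_iff₀ (by positivity),
    abs_lt] at hc
  have hCl : 0 ≤ C * l := by positivity
  have hSl : 0 ≤ (S - 1) * l := mul_nonneg (by linarith) hl.le
  have hs : 0 ≤ t * l := by positivity
  have hdd : d * δ ^ 2 ≤ d * δ / 16 := by nlinarith [mul_pos hd hδ]
  -- The angle bound allows a linear term `2δd · tl`; the squared claim offers `4δd · tl`, and the
  -- excess absorbs the terms of order `l²`, which `hL` makes at most `dδ/16 · tl`.
  have hub : f ^ 2 ≤ (d + 2 * δ * (t * l)) ^ 2 := by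
    have h1 : t * (e ^ 2 - d ^ 2 - l ^ 2) ≤ t * (δ * (2 * d * l)) :=
      mul_le_mul_of_nonneg_left (by linarith [hc.1]) ht0
    have h2 : (t * l) * ((1 + C) * l) ≤ (t * l) * (d * δ / 16) :=
      mul_le_mul_of_nonneg_left (by nlinarith) hs
    have h3 : 0 ≤ C * t * t * l ^ 2 := by positivity
    have h4 : 0 ≤ (t * l) * (d * δ) := by positivity
    nlinarith [sq_nonneg (2 * δ * (t * l))]
  have hlb : (d - 2 * δ * (t * l)) ^ 2 ≤ f ^ 2 := by
    have h1 : t * (-(δ * (2 * d * l))) ≤ t * (e ^ 2 - d ^ 2 - l ^ 2) :=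
      mul_le_mul_of_nonneg_left (by linarith [hc.2]) ht0
    have h2 : (t * l) * (S * l) ≤ (t * l) * (d * δ / 16) :=
      mul_le_mul_of_nonneg_left (by nlinarith) hs
    have h3 : 0 ≤ S * t * t * l ^ 2 := by positivity
    have h4 : 0 ≤ (t * l) * (d * δ) := by positivity
    have h5 : t * l ≤ d := by nlinarith
    have h6 : (t * l) * δ * (δ * (t * l)) ≤ (t * l) * δ * (1 / 16 * d) :=
      mul_le_mul_of_nonneg_left (by nlinarith) (by positivity)
    nlinarith [sq_nonneg (t * l)]
  have hub' := abs_le_of_sq_le_sq hub (by positivity)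
  have hlb' := (abs_le_of_sq_le_sq' hlb hf).2
  rw [abs_le]
  constructor <;> linarith [le_abs_self f]

/-- Along a geodesic making a comparison angle close to `π` with `p`, the distance from `p` grows
almost at unit speed. -/
theorem le_dist_of_pi_sub_lt_compAngle {S δ : ℝ} (hS : 1 ≤ S) (hconc : IsSConcave X S)
    (hδ : 0 < δ) (hδ1 : δ ≤ 1 / 16) {p : X} {ξ : ℝ → X} (hξ : IsConstSpeedGeodesic ξ)
    (hp : p ≠ ξ 0) (hne : ξ 0 ≠ ξ 1) (hang : Real.pi - δ < compAngle p (ξ 0) (ξ 1))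
    (hL : S * dist (ξ 0) (ξ 1) < dist p (ξ 0) * δ ^ 2) {t : ℝ} (ht : t ∈ Icc (0 : ℝ) 1)
    (hsmall : dist (ξ 0) (ξ t) ≤ dist p (ξ 0) * δ) :
    (1 - δ) * dist (ξ 0) (ξ t) ≤ dist p (ξ t) - dist p (ξ 0) := by
  have hd : 0 < dist p (ξ 0) := dist_pos.2 hp
  have hl : 0 < dist (ξ 0) (ξ 1) := dist_pos.2 hne
  have hc := lt_neg_cos_of_lt_arccos hδ (by linarith) hang
  have hcos := Real.one_sub_sq_div_two_le_cos (x := δ)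
  rw [dist_comm (ξ 1) (ξ 0), div_lt_iff₀ (by positivity)] at hc
  have lo := hconc p ξ hξ t ht
  rw [hξ.dist_left ht] at hsmall ⊢
  have hf : 0 ≤ dist p (ξ t) := dist_nonneg
  set d := dist p (ξ 0)
  set l := dist (ξ 0) (ξ 1)
  set e := dist p (ξ 1)
  set f := dist p (ξ t)
  obtain ⟨ht0, ht1⟩ := ht
  have hs : 0 ≤ t * l := by positivity
  have hdl : 0 < d * l := by positivity
  have hdd : d * δ ^ 2 ≤ d * δ / 16 := by nlinarith [mul_pos hd hδ]
  have h0 : d ^ 2 + l ^ 2 - e ^ 2 ≤ -(1 - δ / 32) * (2 * d * l) := by nlinarith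
  have h1 : t * ((1 - δ / 32) * (2 * d * l)) ≤ t * (e ^ 2 - d ^ 2 - l ^ 2) :=
    mul_le_mul_of_nonneg_left (by linarith) ht0
  have h2 : (t * l) * (S * l) ≤ (t * l) * (d * δ / 16) :=
    mul_le_mul_of_nonneg_left (by nlinarith) hs
  have h3 : 0 ≤ S * t * t * l ^ 2 := by positivity
  have h4 : (t * l) * (t * l) ≤ (t * l) * (d * δ) := mul_le_mul_of_nonneg_left hsmall hs
  have h5 : (1 - δ) ^ 2 * ((t * l) * (t * l)) ≤ (t * l) * (t * l) := by
    nlinarith [mul_nonneg hs hs]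
  -- Lowering the speed from `1` to `1 - δ` frees `2δd · tl`; the square `(tl)²` takes at most half
  -- of it by `hsmall`.
  have hlb : (d + (1 - δ) * (t * l)) ^ 2 ≤ f ^ 2 := by
    have h6 : 0 ≤ (t * l) * (d * δ) := by positivity
    nlinarith
  have := (abs_le_of_sq_le_sq' hlb hf).2
  linarith

/-! ### Variational principle and weighted sums. -/

/-- Ekeland's variational principle, for a nonnegative continuous function. -/
theorem exists_dist_le_forall_ne_lt [CompleteSpace X] {g : X → ℝ} (hg : Continuous g)
    (hg0 : ∀ x, 0 ≤ g x) {c : ℝ} (hc : 0 < c) (x : X) :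
    ∃ y, c * dist x y ≤ g x - g y ∧ ∀ z, z ≠ y → g y - g z < c * dist y z := by
  have hbdd : ∀ y, BddBelow (g '' {z | c * dist y z ≤ g y - g z}) := fun y =>
    ⟨0, by rintro _ ⟨z, -, rfl⟩; exact hg0 z⟩
  -- From `y`, pass to an almost minimizer of `g` among the points to which `g` drops at rate at
  -- least `c`.
  have hstep : ∀ (m : ℕ) (y : X), ∃ z, c * dist y z ≤ g y - g z ∧
      ∀ w, c * dist y w ≤ g y - g w → g z - (1 / 2) ^ m < g w := by
    intro m y
    have hne : (g '' {z | c * dist y z ≤ g y - g z}).Nonempty := ⟨g y, y, by simp, rfl⟩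
    obtain ⟨_, ⟨z, hz, rfl⟩, hlt⟩ := exists_lt_of_csInf_lt hne
      (lt_add_of_pos_right _ (show (0 : ℝ) < (1 / 2) ^ m by positivity))
    refine ⟨z, hz, fun w hw => ?_⟩
    have := csInf_le (hbdd y) ⟨w, hw, rfl⟩
    linarith
  choose F hF1 hF2 using hstep
  let u : ℕ → X := fun m => Nat.rec x (fun m y => F m y) m
  have hu : ∀ m, u (m + 1) = F m (u m) := fun m => rfl
  have hle : ∀ m k, c * dist (u m) (u (m + k)) ≤ g (u m) - g (u (m + k)) := by
    intro m k
    induction k with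
    | zero => simp
    | succ k ih =>
      have h1 := hF1 (m + k) (u (m + k))
      rw [← hu] at h1
      have h2 := dist_triangle (u m) (u (m + k)) (u (m + (k + 1)))
      have h3 : m + (k + 1) = m + k + 1 := rfl
      rw [h3] at h2 ⊢
      nlinarith
  have hle' : ∀ m k, m ≤ k → c * dist (u m) (u k) ≤ g (u m) - g (u k) := by
    intro m k hmk
    obtain ⟨j, rfl⟩ := Nat.exists_eq_add_of_le hmk
    exact hle m j
  have hanti : Antitone fun m => g (u m) := by
    intro m k hmk
    have := hle' m k hmk
    have : 0 ≤ c * dist (u m) (u k) := by positivity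
    show g (u k) ≤ g (u m)
    linarith
  have hcauchy : CauchySeq u := by
    have hconv : CauchySeq fun m => g (u m) :=
      (tendsto_atTop_ciInf hanti ⟨0, by rintro _ ⟨m, rfl⟩; exact hg0 _⟩).cauchySeq
    rw [Metric.cauchySeq_iff'] at hconv ⊢
    intro ε hε
    obtain ⟨N, hN⟩ := hconv (c * ε) (by positivity)
    refine ⟨N, fun m hm => ?_⟩
    have h1 := hle' N m hm
    have h2 := hN m hm
    rw [Real.dist_eq, abs_lt] at h2
    rw [dist_comm]
    nlinarith [h2.1]
  obtain ⟨y, hy⟩ := cauchySeq_tendsto_of_complete hcauchy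
  have hlim : ∀ m, c * dist (u m) y ≤ g (u m) - g y := by
    intro m
    refine le_of_tendsto_of_tendsto ((tendsto_const_nhds.dist hy).const_mul c)
      (tendsto_const_nhds.sub ((hg.tendsto y).comp hy)) ?_
    filter_upwards [Filter.eventually_ge_atTop m] with k hk using hle' m k hk
  refine ⟨y, hlim 0, fun z hz => ?_⟩
  by_contra hcon
  rw [not_lt] at hcon
  -- A violating `z` is admissible from every `u m`, hence competes with each almost minimizer `u (m
  -- + 1)`.
  have hgz : ∀ m, g y - (1 / 2) ^ m ≤ g z := by
    intro m
    have h1 : c * dist (u m) z ≤ g (u m) - g z := by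
      have := hlim m
      have := dist_triangle (u m) y z
      nlinarith
    have h2 := hF2 m (u m) z h1
    rw [← hu] at h2
    have h3 := hlim (m + 1)
    have : 0 ≤ c * dist (u (m + 1)) y := by positivity
    linarith
  have hlim0 : Filter.Tendsto (fun m : ℕ => g y - (1 / 2 : ℝ) ^ m) Filter.atTop (𝓝 (g y - 0)) :=
    tendsto_const_nhds.sub (tendsto_pow_atTop_nhds_zero_of_lt_one (by norm_num) (by norm_num))
  have := le_of_tendsto' hlim0 hgz
  have := mul_pos hc (dist_pos.2 hz.symm)
  linarith

/-- A geometrically weighted sum is negative if the `j`-th term is almost `-1`, the preceding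
terms are small and the following ones at most `1`. -/
theorem sum_half_pow_mul_le {δ : ℝ} (hδ : 0 < δ) {k : ℕ} (hk : δ * 2 ^ (k + 2) ≤ 1) (j : Fin k)
    {r : Fin k → ℝ} (h1 : ∀ i < j, r i ≤ 2 * δ) (h2 : r j ≤ -(1 - δ)) (h3 : ∀ i, j < i → r i ≤ 1) :
    ∑ i : Fin k, (1 / 2 : ℝ) ^ (i : ℕ) * r i ≤ -(3 * δ) := by
  set G : ℕ → ℝ := fun i => if i < j then 2 * δ else if i = j then -(1 - δ) else 1 with hG
  have hle : ∑ i : Fin k, (1 / 2 : ℝ) ^ (i : ℕ) * r i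
      ≤ ∑ i : Fin k, (1 / 2 : ℝ) ^ (i : ℕ) * G i := by
    refine Finset.sum_le_sum fun i _ => mul_le_mul_of_nonneg_left ?_ (by positivity)
    simp only [hG]
    split_ifs with ha hb
    · exact h1 i (by exact_mod_cast ha)
    · rw [Fin.ext hb]; exact h2
    · exact h3 i (by rw [Fin.lt_def]; omega)
  have hgeom : ∀ m : ℕ, m ≤ j → ∑ i ∈ Finset.range m, (1 / 2 : ℝ) ^ i * G i
      ≤ 4 * δ * (1 - (1 / 2) ^ m) := by
    intro m
    induction m with
    | zero => simp
    | succ m ih =>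
      intro hm
      have : G m = 2 * δ := by simp only [hG]; rw [if_pos (show m < j by omega)]
      rw [Finset.sum_range_succ, this, pow_succ]
      linarith [ih (by omega)]
  -- The weights after `j` add up to `2⁻ʲ - 2⁻⁽ᵐ⁻¹⁾`, so later terms cannot use up the gain at `j`:
  -- the last weight survives.
  have hsum : ∀ m : ℕ, (j : ℕ) + 1 ≤ m → ∑ i ∈ Finset.range m, (1 / 2 : ℝ) ^ i * G i
      ≤ 5 * δ - (1 / 2) ^ (m - 1) := by
    intro m hm
    induction m, hm using Nat.le_induction with
    | base =>
      have hj : G j = -(1 - δ) := by simp [hG]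
      have hp : (0 : ℝ) < (1 / 2) ^ (j : ℕ) := by positivity
      have hp1 : (1 / 2 : ℝ) ^ (j : ℕ) ≤ 1 := pow_le_one₀ (by norm_num) (by norm_num)
      rw [Finset.sum_range_succ, hj, Nat.add_sub_cancel]
      nlinarith [hgeom j le_rfl]
    | succ m hm ih =>
      have hm1 : G m = 1 := by
        simp only [hG]
        rw [if_neg (show ¬ m < j by omega), if_neg (show ¬ m = j by omega)]
      obtain ⟨l, rfl⟩ : ∃ l, m = l + 1 := ⟨m - 1, by omega⟩
      rw [Finset.sum_range_succ, hm1]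
      simp only [Nat.add_sub_cancel] at ih ⊢
      rw [pow_succ] at *
      linarith
  have hfin := hsum k (by omega)
  rw [← Fin.sum_univ_eq_sum_range (fun i => (1 / 2 : ℝ) ^ i * G i)] at hfin
  have hkk : 8 * δ ≤ (1 / 2) ^ (k - 1) := by
    obtain ⟨l, rfl⟩ : ∃ l, k = l + 1 := ⟨k - 1, by have := j.isLt; omega⟩
    rw [Nat.add_sub_cancel, one_div, inv_pow, ← one_div, le_div_iff₀ (by positivity)]
    calc 8 * δ * 2 ^ l = δ * 2 ^ (l + 1 + 2) := by ring
      _ ≤ 1 := hk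
  linarith

/-! ### Stability of strainers. -/

theorem continuousAt_compAngle {p q x : X} (hp : p ≠ x) (hq : q ≠ x) :
    ContinuousAt (fun y => compAngle p y q) x := by
  have h1 : dist p x ≠ 0 := dist_ne_zero.2 hp
  have h2 : dist q x ≠ 0 := dist_ne_zero.2 hq
  unfold compAngle
  refine Real.continuous_arccos.continuousAt.comp (ContinuousAt.div ?_ ?_ (by positivity)) <;>
    fun_prop

theorem continuousAt_arccos_one_sub {K : ℝ} {p q x : X} (hp : p ≠ x) :
    ContinuousAt (fun y => Real.arccos (1 - K * dist q y / (2 * dist p y))) x := by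
  have h1 : dist p x ≠ 0 := dist_ne_zero.2 hp
  refine Real.continuous_arccos.continuousAt.comp (continuousAt_const.sub
    (ContinuousAt.div ?_ ?_ (by positivity))) <;> fun_prop

/-- All conditions are strict and continuous at `x`, and the opposite strainers of `x` also serve
nearby points. -/
theorem isOpen_setOf_isStrainer (S C R δ : ℝ) {k : ℕ} (p : Fin k → X) :
    IsOpen {x | IsStrainer S C R δ p x} := by
  rw [isOpen_iff_mem_nhds]
  rintro x ⟨h0, h⟩
  have hp : ∀ j, p j ≠ x := fun j => (h j).2.choose_spec.1.1
  have hpe : ∀ j, ∀ᶠ y in 𝓝 x, p j ≠ y := fun j =>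
    (isOpen_ne.eventually_mem (hp j).symm).mono fun _ hy => Ne.symm hy
  have e1 : ∀ᶠ y in 𝓝 x, ∀ h : 0 < k, dist (p ⟨0, h⟩) y < R := by
    by_cases hk : 0 < k
    · filter_upwards [(Continuous.tendsto (by fun_prop) x).eventually_lt_const (h0 hk)] with y hy _
        using hy
    · exact Filter.Eventually.of_forall fun y h => absurd h hk
  have e2 : ∀ j : Fin k, ∀ᶠ y in 𝓝 x, ∀ i < j,
      Real.arccos (1 - (S + C) * dist (p j) y / (2 * dist (p i) y)) < δ := by
    intro j
    refine Filter.eventually_all.2 fun i => ?_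
    by_cases hij : i < j
    · filter_upwards [(continuousAt_arccos_one_sub (hp i)).eventually_lt_const
        ((h j).1 i hij)] with y hy _ using hy
    · exact Filter.Eventually.of_forall fun y h => absurd h hij
  have e3 : ∀ j : Fin k, ∀ᶠ y in 𝓝 x, ∃ q : X, IsStrainerPair S δ (p j) q y ∧
      ∀ i < j, |compAngle (p i) y (p j) - Real.pi / 2| < δ ∧
        |compAngle (p i) y q - Real.pi / 2| < δ := by
    intro j
    obtain ⟨q, ⟨-, hq, hang, hsm⟩, hperp⟩ := (h j).2
    have hperp' : ∀ᶠ y in 𝓝 x, ∀ i < j, |compAngle (p i) y (p j) - Real.pi / 2| < δ ∧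
        |compAngle (p i) y q - Real.pi / 2| < δ := by
      refine Filter.eventually_all.2 fun i => ?_
      by_cases hij : i < j
      · filter_upwards [((continuousAt_compAngle (hp i) (hp j)).sub
            continuousAt_const).abs.eventually_lt_const (hperp i hij).1,
          ((continuousAt_compAngle (hp i) hq).sub
            continuousAt_const).abs.eventually_lt_const (hperp i hij).2] with y h1 h2 _
          using ⟨h1, h2⟩
      · exact Filter.Eventually.of_forall fun y h => absurd h hij
    filter_upwards [hpe j, (isOpen_ne.eventually_mem hq.symm).mono fun _ hy => Ne.symm hy,
      (continuousAt_compAngle (hp j) hq).eventually_const_lt hang,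
      (continuousAt_arccos_one_sub (hp j)).eventually_lt_const hsm, hperp'] with y h1 h2 h3 h4 h5
    exact ⟨q, ⟨h1, h2, h3, h4⟩, h5⟩
  filter_upwards [e1, Filter.eventually_all.2 e2, Filter.eventually_all.2 e3] with y h1 h2 h3
  exact ⟨h1, fun j => ⟨h2 j, h3 j⟩⟩

theorem isOpen_strainedSet (S C R : ℝ) (k : ℕ) (δ : ℝ) : IsOpen (strainedSet X S C R k δ) := by
  have : strainedSet X S C R k δ = ⋃ p : Fin k → X, {x | IsStrainer S C R δ p x} := by
    ext x
    simp [strainedSet]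
  rw [this]
  exact isOpen_iUnion fun p => isOpen_setOf_isStrainer S C R δ p

theorem IsStrainer.mono {S C R R' δ δ' : ℝ} (hR : R ≤ R') (hδ : δ ≤ δ') {k : ℕ} {p : Fin k → X}
    {x : X} (h : IsStrainer S C R δ p x) : IsStrainer S C R' δ' p x := by
  refine ⟨fun hk => (h.1 hk).trans_le hR, fun j => ⟨fun i hi => ((h.2 j).1 i hi).trans_le hδ, ?_⟩⟩
  obtain ⟨q, ⟨h1, h2, h3, h4⟩, h5⟩ := (h.2 j).2
  exact ⟨q, ⟨h1, h2, by linarith, h4.trans_le hδ⟩,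
    fun i hi => ⟨(h5 i hi).1.trans_le hδ, (h5 i hi).2.trans_le hδ⟩⟩

theorem strainedSet_mono {S C R R' δ δ' : ℝ} (hR : R ≤ R') (hδ : δ ≤ δ') (k : ℕ) :
    strainedSet X S C R k δ ⊆ strainedSet X S C R' k δ' :=
  fun _ ⟨p, hp⟩ => ⟨p, hp.mono hR hδ⟩

theorem IsStrainer.ne {S C R δ : ℝ} {k : ℕ} {p : Fin k → X} {x : X} (h : IsStrainer S C R δ p x)
    (i : Fin k) : p i ≠ x := (h.2 i).2.choose_spec.1.1

theorem IsStrainer.mul_dist_lt {S C R δ : ℝ} (hδ : 0 < δ) (hδ1 : δ ≤ 1) {k : ℕ} {p : Fin k → X}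
    {x : X} (h : IsStrainer S C R δ p x) {i j : Fin k} (hij : i < j) :
    (S + C) * dist (p j) x < dist (p i) x * δ ^ 2 :=
  mul_lt_of_arccos_one_sub_lt (dist_pos.2 (h.ne i)) hδ hδ1 ((h.2 j).1 i hij)

/-- By definition only the first distance is bounded; the ratio condition makes the later ones
smaller, as `S + C ≥ 1`. -/
theorem IsStrainer.dist_lt {S C R δ : ℝ} (hS : 1 ≤ S) (hC : 0 ≤ C) (hδ : 0 < δ) (hδ1 : δ ≤ 1)
    {k : ℕ} {p : Fin k → X} {x : X} (h : IsStrainer S C R δ p x) (i : Fin k) :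
    dist (p i) x < R := by
  have hk : 0 < k := i.pos
  have h0 := h.1 hk
  rcases Nat.eq_zero_or_pos (i : ℕ) with hi | hi
  · rwa [show i = ⟨0, hk⟩ from Fin.ext hi]
  · have h1 := h.mul_dist_lt hδ hδ1 (i := ⟨0, hk⟩) (j := i) (by rwa [Fin.lt_def])
    have h2 : 0 ≤ dist (p i) x := dist_nonneg
    have h3 : 0 ≤ dist (p ⟨0, hk⟩) x := dist_nonneg
    have h4 : δ ^ 2 ≤ 1 := by nlinarith
    nlinarith

/-! ### Openness of strainer maps. -/

theorem exists_mul_le {l m : ℝ} (hl : 0 < l) (hm : 0 < m) :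
    ∃ t ∈ Icc (0 : ℝ) 1, 0 < t * l ∧ t * l ≤ m := by
  have h : 0 < min 1 (m / l) := lt_min one_pos (by positivity)
  refine ⟨min 1 (m / l), ⟨h.le, min_le_left _ _⟩, by positivity, ?_⟩
  calc min 1 (m / l) * l ≤ m / l * l := by gcongr; exact min_le_right _ _
    _ = m := by field_simp

/-- At a strained point one can move so that the `j`-th distance approaches a prescribed value at
almost unit speed, while the preceding distances hardly change. -/
theorem IsStrainer.exists_step {S C D R δ : ℝ} (hS : 1 ≤ S) (hC : 0 ≤ C)
    (hgeo : IsGeodesicSpace X) (hconc : IsSConcave X S) (hconv : IsLocallySemiConvex X C D)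
    (hδ : 0 < δ) (hδ1 : δ ≤ 1 / 16) (hRD : (1 + δ ^ 2) * R ≤ D) {k : ℕ} {p : Fin k → X} {y : X}
    (h : IsStrainer S C R δ p y) (j : Fin k) {u : ℝ} (hu : u ≠ 0) :
    ∃ z, z ≠ y ∧ (∀ i < j, |dist (p i) z - dist (p i) y| ≤ 2 * δ * dist y z) ∧
      |u - (dist (p j) z - dist (p j) y)| ≤ |u| - (1 - δ) * dist y z := by
  have hD : ∀ i, (1 + δ ^ 2) * dist (p i) y < D := fun i => by
    have := h.dist_lt hS hC hδ (by linarith) i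
    nlinarith [sq_nonneg δ]
  obtain ⟨q, ⟨hpj, hq, hang, hsm⟩, hperp⟩ := (h.2 j).2
  have hSq := mul_lt_of_arccos_one_sub_lt (dist_pos.2 hpj) hδ (by linarith) hsm
  -- To decrease the distance, move towards `p j`; to increase it, towards `q`. The step has length
  -- at most `|u|`, so the target is not overshot.
  rcases lt_or_gt_of_ne hu with hu | hu
  · obtain ⟨ξ, hξ, h0, h1⟩ := hgeo y (p j)
    subst h0
    have hl : 0 < dist (ξ 0) (ξ 1) := by rw [h1]; exact dist_pos.2 hpj.symm
    obtain ⟨t, ht, hpos, hle⟩ := exists_mul_le hl (neg_pos.2 hu)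
    have hdt := hξ.dist_left ht
    refine ⟨ξ t, fun hc => ?_, fun i hi => ?_, ?_⟩
    · rw [hc, dist_self] at hdt
      linarith
    · refine abs_dist_sub_le_of_compAngle hS hC hconc hconv hδ hδ1 hξ (h.ne i)
        (dist_pos.1 hl) ?_ ?_ (hD i) ht
      · rw [h1]; exact (hperp i hi).1
      · rw [h1, dist_comm]; exact h.mul_dist_lt hδ (by linarith) hi
    · have h2 := hξ.dist_right ht
      have h3 : dist (p j) (ξ t) - dist (p j) (ξ 0) = -(t * dist (ξ 0) (ξ 1)) := by
        rw [← h1, dist_comm (ξ 1), h2, dist_comm (ξ 1)]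
        ring
      rw [h3, hdt, abs_of_neg hu, abs_of_nonpos (by linarith)]
      nlinarith
  · obtain ⟨ξ, hξ, h0, h1⟩ := hgeo y q
    subst h0
    have hl : 0 < dist (ξ 0) (ξ 1) := by rw [h1]; exact dist_pos.2 hq.symm
    have hdj : 0 < dist (p j) (ξ 0) := dist_pos.2 hpj
    obtain ⟨t, ht, hpos, hle⟩ := exists_mul_le hl (lt_min hu (mul_pos hdj hδ))
    have hdt := hξ.dist_left ht
    refine ⟨ξ t, fun hc => ?_, fun i hi => ?_, ?_⟩
    · rw [hc, dist_self] at hdt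
      linarith
    · refine abs_dist_sub_le_of_compAngle hS hC hconc hconv hδ hδ1 hξ (h.ne i)
        (dist_pos.1 hl) ?_ ?_ (hD i) ht
      · rw [h1]; exact (hperp i hi).2
      · rw [h1, dist_comm]
        have h2 := h.mul_dist_lt hδ (by linarith) hi
        -- The ratio condition bounds `p j` only; `q` inherits it, being closer than `p j`.
        have h3 : dist q (ξ 0) ≤ dist (p j) (ξ 0) := by
          have : 0 ≤ dist q (ξ 0) := dist_nonneg
          have : δ ^ 2 ≤ 1 := by nlinarith
          nlinarith
        nlinarith
    · have h2 := le_dist_of_pi_sub_lt_compAngle hS hconc hδ hδ1 hξ hpj (dist_pos.1 hl)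
        (by rwa [h1]) (by rwa [h1, dist_comm (ξ 0) q]) ht
        (by rw [hdt]; exact hle.trans (min_le_right _ _))
      have h3 := dist_triangle (p j) (ξ 0) (ξ t)
      have h4 := hle.trans (min_le_left _ _)
      rw [hdt] at h2 h3 ⊢
      rw [abs_of_pos hu, abs_of_nonneg (by linarith)]
      linarith

/-- The strainer map is open on the set where the tuple is a strainer. -/
theorem isOpen_image_strainerMap [CompleteSpace X] {S C D R δ : ℝ} (hS : 1 ≤ S) (hC : 0 ≤ C)
    (hgeo : IsGeodesicSpace X) (hconc : IsSConcave X S) (hconv : IsLocallySemiConvex X C D)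
    (hδ : 0 < δ) (hδ1 : δ ≤ 1 / 16) (hRD : (1 + δ ^ 2) * R ≤ D) {k : ℕ}
    (hk : δ * 2 ^ (k + 2) ≤ 1) {p : Fin k → X} {V : Set X} (hV : IsOpen V)
    (h : ∀ y ∈ V, IsStrainer S C R δ p y) : IsOpen (strainerMap p '' V) := by
  rw [isOpen_iff_mem_nhds]
  rintro _ ⟨y, hy, rfl⟩
  obtain ⟨ρ, hρ, hball⟩ := Metric.isOpen_iff.1 hV y hy
  set g : EuclideanSpace ℝ (Fin k) → X → ℝ :=
    fun a z => ∑ i : Fin k, (1 / 2 : ℝ) ^ (i : ℕ) * |a i - dist (p i) z| with hg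
  have hcont : Continuous fun a => g a y := by
    simp only [hg]
    fun_prop
  have hy0 : g (strainerMap p y) y = 0 := by simp [hg, strainerMap]
  filter_upwards [hcont.continuousAt.eventually_lt_const (u := 3 * δ * ρ)
    (by show g _ y < _; rw [hy0]; positivity)] with a ha
  -- The rate `3δ` is what `sum_half_pow_mul_le` guarantees; as `g a y < 3δρ`, the point `z` stays
  -- in the ball.
  obtain ⟨z, hz1, hz2⟩ := exists_dist_le_forall_ne_lt (g := g a) (c := 3 * δ)
    (by simp only [hg]; fun_prop) (fun z => Finset.sum_nonneg fun i _ => by positivity)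
    (by positivity) y
  have hga : 0 ≤ g a z := Finset.sum_nonneg fun i _ => by positivity
  have hzV : z ∈ V := hball (by
    rw [Metric.mem_ball, dist_comm]
    exact lt_of_mul_lt_mul_left (by linarith) (show 0 ≤ 3 * δ by positivity))
  refine ⟨z, hzV, ?_⟩
  by_contra hne
  obtain ⟨j, hj⟩ : ∃ j, a j - dist (p j) z ≠ 0 := by
    by_contra hc
    push Not at hc
    exact hne (by ext i; simpa [strainerMap] using (sub_eq_zero.1 (hc i)).symm)
  obtain ⟨w, hw, hw1, hw2⟩ := (h z hzV).exists_step hS hC hgeo hconc hconv hδ hδ1 hRD j hj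
  have hs : 0 < dist z w := dist_pos.2 hw.symm
  have hsum := sum_half_pow_mul_le hδ hk j
    (r := fun i => (|a i - dist (p i) w| - |a i - dist (p i) z|) / dist z w) ?_ ?_ ?_
  · have heq : ∑ i : Fin k, (1 / 2 : ℝ) ^ (i : ℕ) *
        ((|a i - dist (p i) w| - |a i - dist (p i) z|) / dist z w) = (g a w - g a z) / dist z w := by
      simp only [hg]
      rw [← Finset.sum_sub_distrib, Finset.sum_div]
      exact Finset.sum_congr rfl fun i _ => by ring
    rw [heq, div_le_iff₀ hs] at hsum
    linarith [hz2 w hw]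
  · intro i hi
    rw [div_le_iff₀ hs]
    have h1 := hw1 i hi
    have h2 := abs_sub_abs_le_abs_sub (a i - dist (p i) w) (a i - dist (p i) z)
    rw [show a i - dist (p i) w - (a i - dist (p i) z) = -(dist (p i) w - dist (p i) z) by ring,
      abs_neg] at h2
    linarith
  · rw [div_le_iff₀ hs]
    rw [show a j - dist (p j) z - (dist (p j) w - dist (p j) z) = a j - dist (p j) w by ring] at hw2
    linarith
  · intro i _
    rw [div_le_iff₀ hs]
    have h2 := abs_sub_abs_le_abs_sub (a i - dist (p i) w) (a i - dist (p i) z)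
    rw [show a i - dist (p i) w - (a i - dist (p i) z) = dist z (p i) - dist w (p i) by
      rw [dist_comm z, dist_comm w]; ring] at h2
    linarith [abs_dist_sub_le z w (p i)]

/-! ### Lower bound for the Hausdorff dimension. -/

theorem dist_strainerMap_le {k : ℕ} (p : Fin k → X) (y z : X) :
    dist (strainerMap p y) (strainerMap p z) ≤ √k * dist y z := by
  rw [EuclideanSpace.dist_eq]
  calc √(∑ i, dist (strainerMap p y i) (strainerMap p z i) ^ 2)
      ≤ √(∑ _i : Fin k, dist y z ^ 2) := by
        refine Real.sqrt_le_sqrt (Finset.sum_le_sum fun i _ => ?_)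
        refine pow_le_pow_left₀ dist_nonneg ?_ 2
        simp only [strainerMap, Real.dist_eq]
        rw [dist_comm _ y, dist_comm _ z]
        exact abs_dist_sub_le y z (p i)
    _ = √k * dist y z := by
        rw [Finset.sum_const, Finset.card_univ, Fintype.card_fin, nsmul_eq_mul,
          Real.sqrt_mul (by positivity), Real.sqrt_sq dist_nonneg]

theorem lipschitzWith_strainerMap {k : ℕ} (p : Fin k → X) :
    LipschitzWith (√k).toNNReal (strainerMap p) :=
  LipschitzWith.of_dist_le_mul fun y z => by
    rw [Real.coe_toNNReal _ (by positivity)]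
    exact dist_strainerMap_le p y z

theorem dimH_of_isOpen_euclideanSpace {k : ℕ} {W : Set (EuclideanSpace ℝ (Fin k))}
    (hW : IsOpen W) (hne : W.Nonempty) : dimH W = k := by
  rw [Real.dimH_of_nonempty_interior (by rwa [hW.interior_eq]), finrank_euclideanSpace_fin]

/-- A space with a `k`-strained point has Hausdorff dimension at least `k`. -/
theorem IsStrainer.le_dimH [CompleteSpace X] {S C D R δ : ℝ} (hS : 1 ≤ S) (hC : 0 ≤ C)
    (hgeo : IsGeodesicSpace X) (hconc : IsSConcave X S) (hconv : IsLocallySemiConvex X C D)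
    (hδ : 0 < δ) (hδ1 : δ ≤ 1 / 16) (hRD : (1 + δ ^ 2) * R ≤ D) {k : ℕ}
    (hk : δ * 2 ^ (k + 2) ≤ 1) {p : Fin k → X} {x : X} (h : IsStrainer S C R δ p x) :
    (k : ENNReal) ≤ dimH (univ : Set X) := by
  have hopen := isOpen_image_strainerMap hS hC hgeo hconc hconv hδ hδ1 hRD hk
    (isOpen_setOf_isStrainer S C R δ p) (fun _ hy => hy)
  rw [← dimH_of_isOpen_euclideanSpace hopen ⟨_, mem_image_of_mem _ h⟩]
  exact ((lipschitzWith_strainerMap p).dimH_image_le _).trans (dimH_mono (subset_univ _))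

/-! ### Extension of strainers. -/

theorem arccos_one_sub_lt {v δ : ℝ} (hδ : 0 < δ) (hv : 0 ≤ v) (h : v < 1 - Real.cos δ) :
    Real.arccos (1 - v) < δ := by
  by_contra hc
  have h1 := Real.cos_le_cos_of_nonneg_of_le_pi hδ.le (Real.arccos_le_pi _) (not_lt.1 hc)
  rw [Real.cos_arccos (by linarith [Real.neg_one_le_cos δ]) (by linarith)] at h1
  linarith

theorem abs_arccos_sub_lt {u δ : ℝ} (hδ : 0 < δ) (hδ1 : δ ≤ 1) (h : |u| ≤ δ / 2) :
    |Real.arccos u - Real.pi / 2| < δ := by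
  have hs : δ / 2 < Real.sin δ := by
    have := Real.sin_gt_sub_cube hδ
    nlinarith [pow_pos hδ 3, pow_pos hδ 2]
  have hpi := Real.pi_gt_three
  have key : ∀ v : ℝ, v ≤ δ / 2 → Real.arcsin v < δ := fun v hv =>
    (Real.arcsin_lt_iff_lt_sin' ⟨by linarith, by linarith⟩).2 (hv.trans_lt hs)
  have h1 := key u (le_of_abs_le h)
  have h2 := key (-u) (by linarith [neg_abs_le u])
  rw [Real.arcsin_neg] at h2
  rw [Real.arccos_eq_pi_div_two_sub_arcsin, abs_lt]
  constructor <;> linarith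

theorem IsConstSpeedGeodesic.compAngle_eq_pi {ξ : ℝ → X} (hξ : IsConstSpeedGeodesic ξ)
    (hne : ξ 0 ≠ ξ 1) {s t : ℝ} (hs : 0 < s) (hst : s < t) (ht : t ≤ 1) :
    compAngle (ξ 0) (ξ s) (ξ t) = Real.pi := by
  have hl := dist_pos.2 hne
  unfold compAngle
  rw [hξ 0 (by simp) s ⟨hs.le, by linarith⟩, hξ t ⟨by linarith, ht⟩ s ⟨hs.le, by linarith⟩,
    hξ 0 (by simp) t ⟨by linarith, ht⟩, zero_sub, zero_sub, abs_neg, abs_neg, abs_of_pos hs,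
    abs_of_pos (by linarith : (0 : ℝ) < t), abs_of_pos (by linarith : 0 < t - s)]
  have h1 : 0 < t - s := by linarith
  rw [show (((s * dist (ξ 0) (ξ 1)) ^ 2 + ((t - s) * dist (ξ 0) (ξ 1)) ^ 2 -
    (t * dist (ξ 0) (ξ 1)) ^ 2) / (2 * (s * dist (ξ 0) (ξ 1)) * ((t - s) * dist (ξ 0) (ξ 1))))
    = -1 by field_simp; ring]
  exact Real.arccos_neg_one

/-- If the distance from `p` is almost equal at the ends of a short geodesic, then the geodesic is
almost perpendicular to the direction of `p`. -/
theorem abs_compAngle_sub_lt {S C D δ ε τ : ℝ} (hS : 1 ≤ S) (hC : 0 ≤ C) (hconc : IsSConcave X S)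
    (hconv : IsLocallySemiConvex X C D) (hδ : 0 < δ) (hδ1 : δ ≤ 1) (hτ : 0 < τ)
    {p : X} {ξ : ℝ → X} (hξ : IsConstSpeedGeodesic ξ) (hne : ξ 0 ≠ ξ 1)
    (hlt : ∀ t ∈ Icc (0 : ℝ) 1, dist p (ξ t) < D)
    (hε' : |dist p (ξ 0) - dist p (ξ 1)| ≤ ε * dist (ξ 0) (ξ 1)) {s t : ℝ}
    (hs : s ∈ Icc (0 : ℝ) 1) (ht : t ∈ Icc (0 : ℝ) 1) (hst : τ ≤ |s - t|) (hp : p ≠ ξ s)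
    (hsmall : 2 * D * ε + (S + C + 1) * dist (ξ 0) (ξ 1) / τ ≤ dist p (ξ s) * δ) :
    |compAngle p (ξ s) (ξ t) - Real.pi / 2| < δ := by
  have hl := dist_pos.2 hne
  have ha := dist_pos.2 hp
  have hD0 := hlt 0 (by simp)
  have hD1 := hlt 1 (by simp)
  have hσ1 : |s - t| ≤ 1 := by
    rw [abs_le]; constructor <;> linarith [hs.1, hs.2, ht.1, ht.2]
  -- Concavity and semi-convexity together make the squared distance affine along `ξ` up to order
  -- `l²`.
  have hquad : ∀ t ∈ Icc (0 : ℝ) 1, |dist p (ξ t) ^ 2 -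
      ((1 - t) * dist p (ξ 0) ^ 2 + t * dist p (ξ 1) ^ 2)| ≤ (S + C) * dist (ξ 0) (ξ 1) ^ 2 / 4 := by
    intro t ht
    have lo := hconc p ξ hξ t ht
    have up := hconv p ξ hξ hlt t ht
    have h4 : t * (1 - t) ≤ 1 / 4 := by nlinarith [sq_nonneg (t - 1 / 2)]
    have h5 : S * dist (ξ 0) (ξ 1) ^ 2 * (t * (1 - t)) ≤ S * dist (ξ 0) (ξ 1) ^ 2 * (1 / 4) :=
      mul_le_mul_of_nonneg_left h4 (by positivity)
    have h6 : C * dist (ξ 0) (ξ 1) ^ 2 * (t * (1 - t)) ≤ C * dist (ξ 0) (ξ 1) ^ 2 * (1 / 4) :=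
      mul_le_mul_of_nonneg_left h4 (by positivity)
    have h7 : 0 ≤ S * dist (ξ 0) (ξ 1) ^ 2 := by positivity
    have h8 : 0 ≤ C * dist (ξ 0) (ξ 1) ^ 2 := by positivity
    rw [abs_le]
    constructor <;> linarith
  have hends : |dist p (ξ 1) ^ 2 - dist p (ξ 0) ^ 2| ≤ 2 * D * ε * dist (ξ 0) (ξ 1) := by
    rw [sq_sub_sq, abs_mul, abs_of_nonneg (by positivity), abs_sub_comm]
    calc _ ≤ (2 * D) * (ε * dist (ξ 0) (ξ 1)) := by
          refine mul_le_mul (by linarith) hε' (abs_nonneg _) ?_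
          linarith [dist_nonneg (x := p) (y := ξ 0)]
      _ = _ := by ring
  have h1 := hquad s hs
  have h2 := hquad t ht
  have h3 : |(s - t) * (dist p (ξ 1) ^ 2 - dist p (ξ 0) ^ 2)|
      ≤ |s - t| * (2 * D * ε * dist (ξ 0) (ξ 1)) := by
    rw [abs_mul]
    exact mul_le_mul_of_nonneg_left hends (abs_nonneg _)
  refine abs_arccos_sub_lt hδ hδ1 ?_
  rw [dist_comm (ξ t) (ξ s), hξ s hs t ht]
  have hσ : 0 < |s - t| := hτ.trans_le hst
  rw [abs_div, abs_of_pos (show 0 < 2 * dist p (ξ s) * (|s - t| * dist (ξ 0) (ξ 1)) by positivity),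
    div_le_iff₀ (by positivity)]
  set σ := |s - t|
  set l := dist (ξ 0) (ξ 1)
  set a := dist p (ξ s)
  set b := dist p (ξ t)
  -- Errors of order `l²` are measured against the side `σ l`, which costs a factor `1/τ`.
  have hdiv : (S + C + 1) * l ≤ (S + C + 1) * l / τ * σ := by
    rw [div_mul_eq_mul_div, le_div_iff₀ hτ]
    exact mul_le_mul_of_nonneg_left hst (by positivity)
  have hmain : (2 * D * ε * σ + (S + C + 1) * l) * l ≤ a * δ * σ * l := by
    refine mul_le_mul_of_nonneg_right ?_ hl.le
    nlinarith
  have hσσ : (σ * l) ^ 2 ≤ l ^ 2 := by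
    refine pow_le_pow_left₀ (by positivity) ?_ 2
    nlinarith
  have hSC : 0 ≤ (S + C) * l ^ 2 := by positivity
  rw [abs_le] at h1 h2 h3 ⊢
  constructor <;> linarith [h1.1, h1.2, h2.1, h2.2, h3.1, h3.2, sq_nonneg (σ * l)]

/-- Each entry is tested only against earlier ones, so appending a point leaves the old conditions
intact. -/
theorem isStrainer_snoc {S C R δ : ℝ} (hS : 1 ≤ S) (hC : 0 ≤ C) (hδ : 0 < δ) (hδ1 : δ ≤ 1) {k : ℕ}
    {p : Fin k → X} {x y q : X} (h : IsStrainer S C R δ p x) (hy : dist y x < R)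
    (hlen : ∀ i, Real.arccos (1 - (S + C) * dist y x / (2 * dist (p i) x)) < δ)
    (hpair : IsStrainerPair S δ y q x)
    (hperp : ∀ i, |compAngle (p i) x y - Real.pi / 2| < δ ∧
      |compAngle (p i) x q - Real.pi / 2| < δ) :
    IsStrainer S C R δ (Fin.snoc p y : Fin (k + 1) → X) x := by
  refine ⟨fun hk => ?_, fun j => ?_⟩
  · have : ∀ i, dist ((Fin.snoc p y : Fin (k + 1) → X) i) x < R := by
      intro i
      induction i using Fin.lastCases with
      | last => rwa [Fin.snoc_last]
      | cast i => rw [Fin.snoc_castSucc]; exact h.dist_lt hS hC hδ hδ1 i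
    exact this _
  · induction j using Fin.lastCases with
    | last =>
      refine ⟨fun i hi => ?_, q, ?_, fun i hi => ?_⟩
      · induction i using Fin.lastCases with
        | last => exact absurd hi (lt_irrefl _)
        | cast i => rw [Fin.snoc_last, Fin.snoc_castSucc]; exact hlen i
      · rwa [Fin.snoc_last]
      · induction i using Fin.lastCases with
        | last => exact absurd hi (lt_irrefl _)
        | cast i => rw [Fin.snoc_last, Fin.snoc_castSucc]; exact hperp i
    | cast j =>
      obtain ⟨h1, q', h2, h3⟩ := h.2 j
      refine ⟨fun i hi => ?_, q', ?_, fun i hi => ?_⟩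
      · induction i using Fin.lastCases with
        | last => exact absurd hi (not_lt.2 (Fin.le_last _))
        | cast i => rw [Fin.snoc_castSucc, Fin.snoc_castSucc]; exact h1 i (by simpa using hi)
      · rwa [Fin.snoc_castSucc]
      · induction i using Fin.lastCases with
        | last => exact absurd hi (not_lt.2 (Fin.le_last _))
        | cast i => rw [Fin.snoc_castSucc, Fin.snoc_castSucc]; exact h3 i (by simpa using hi)

/-- If two points near a strained point are not separated well by the strainer map, then the
strainer can be extended at a nearby point. -/
theorem IsStrainer.exists_extension {S C D R δ : ℝ} (hS : 1 ≤ S) (hC : 0 ≤ C)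
    (hgeo : IsGeodesicSpace X) (hconc : IsSConcave X S) (hconv : IsLocallySemiConvex X C D)
    (hδ : 0 < δ) (hδ1 : δ ≤ 1) (hR : 0 < R) (hRD : R ≤ D) {k : ℕ} {p : Fin k → X} {x : X}
    (h : IsStrainer S C R δ p x) {ρ : ℝ} (hρ : 0 < ρ) :
    ∃ ε > 0, ∃ r > 0, ∀ y ∈ Metric.ball x r, ∀ z ∈ Metric.ball x r, y ≠ z →
      (∀ i, |dist (p i) y - dist (p i) z| ≤ ε * dist y z) →
      ∃ w ∈ Metric.ball x ρ, w ∈ strainedSet X S C R (k + 1) δ := by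
  obtain ⟨m, hm, hm1, hm2⟩ : ∃ m : ℝ, 0 < m ∧ (∀ i, m ≤ dist (p i) x) ∧
      ∀ i, dist (p i) x + m ≤ R := by
    have hfin : ∀ᶠ m : ℝ in 𝓝[>] 0, 0 < m ∧ (∀ i, m ≤ dist (p i) x) ∧
        ∀ i, dist (p i) x + m ≤ R := by
      refine eventually_mem_nhdsWithin.and
        (.and (Filter.eventually_all.2 fun i => ?_) (Filter.eventually_all.2 fun i => ?_))
      · exact nhdsWithin_le_nhds (Iic_mem_nhds (dist_pos.2 (h.ne i)))
      · have := h.dist_lt hS hC hδ hδ1 i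
        filter_upwards [nhdsWithin_le_nhds (Iic_mem_nhds (sub_pos.2 this))] with m hm
        have : m ≤ R - dist (p i) x := hm
        linarith
    exact hfin.exists
  obtain ⟨ρ', hρ', hball⟩ := Metric.isOpen_iff.1
    ((isOpen_setOf_isStrainer S C R δ p).inter Metric.isOpen_ball) x ⟨h, Metric.mem_ball_self hρ⟩
  have hcos : Real.cos δ < 1 := by
    rw [← Real.cos_zero]
    exact Real.cos_lt_cos_of_nonneg_of_le_pi le_rfl (by linarith [Real.pi_gt_three]) hδ
  set κ := 1 - Real.cos δ with hκ
  have hκ0 : 0 < κ := by linarith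
  have hκ1 : κ ≤ 1 := by
    have := Real.one_sub_sq_div_two_le_cos (x := δ)
    nlinarith
  -- At the midpoint, the new strainer lies at distance `l/2` and its opposite at `τl`; the ratio in
  -- `IsStrainerPair` is then `Sτ = κ/2`.
  set τ := κ / (2 * S) with hτ
  have hτ0 : 0 < τ := by positivity
  have hSτ : S * τ < κ := by
    rw [hτ, show S * (κ / (2 * S)) = κ / 2 by field_simp]
    linarith
  have hτ1 : τ ≤ 1 / 2 := by
    rw [hτ, div_le_iff₀ (by positivity)]
    linarith
  have hD : 0 < D := hR.trans_le hRD
  obtain ⟨r, hr0, hr1, hr2, hr3, hr4, hr5⟩ : ∃ r : ℝ, 0 < r ∧ 2 * r ≤ ρ' ∧ 4 * r ≤ m ∧ r ≤ R ∧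
      (S + C) * r < m * κ ∧ 8 * (S + C + 1) * r ≤ τ * m * δ := by
    have hfin : ∀ᶠ r : ℝ in 𝓝[>] 0, 0 < r ∧ 2 * r ≤ ρ' ∧ 4 * r ≤ m ∧ r ≤ R ∧
      (S + C) * r < m * κ ∧ 8 * (S + C + 1) * r ≤ τ * m * δ := by
      have hlin : ∀ K b : ℝ, 0 < b → ∀ᶠ r : ℝ in 𝓝[>] 0, K * r < b := fun K b hb =>
        nhdsWithin_le_nhds (((continuous_const.mul continuous_id).tendsto' 0 0
          (by simp)).eventually_lt_const hb)
      filter_upwards [self_mem_nhdsWithin, hlin 2 ρ' hρ', hlin 4 m hm, hlin 1 R hR,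
        hlin (S + C) (m * κ) (by positivity), hlin (8 * (S + C + 1)) (τ * m * δ) (by positivity)]
        with r h1 h2 h3 h4 h5 h6
      exact ⟨h1, h2.le, h3.le, by linarith, h5, h6.le⟩
    exact hfin.exists
  -- With this `ε` the term `2Dε` is `mδ/4`, half of the available `(m/2)δ`; the choice of `r` pays
  -- for the other half.
  refine ⟨m * δ / (8 * D), by positivity, r, hr0, fun y hy z hz hyz hsep => ?_⟩
  obtain ⟨ξ, hξ, rfl, rfl⟩ := hgeo y z
  rw [Metric.mem_ball] at hy hz
  have hl : 0 < dist (ξ 0) (ξ 1) := dist_pos.2 hyz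
  have hl2 : dist (ξ 0) (ξ 1) < 2 * r := by
    have := dist_triangle_right (ξ 0) (ξ 1) x
    linarith
  have hhalf : (1 / 2 : ℝ) ∈ Icc (0 : ℝ) 1 := by constructor <;> norm_num
  have hhalfτ : (1 / 2 + τ : ℝ) ∈ Icc (0 : ℝ) 1 := by constructor <;> linarith
  have hnear : ∀ t ∈ Icc (0 : ℝ) 1, dist (ξ t) x < r + t * dist (ξ 0) (ξ 1) := by
    intro t ht
    have h1 := dist_triangle_left (ξ t) x (ξ 0)
    rw [hξ.dist_left ht] at h1
    linarith
  have hw := hnear _ hhalf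
  have hwl : dist (ξ 0) (ξ (1 / 2)) = dist (ξ 0) (ξ 1) / 2 := by
    rw [hξ.dist_left hhalf]; ring
  have hwq : dist (ξ (1 / 2 + τ)) (ξ (1 / 2)) = τ * dist (ξ 0) (ξ 1) := by
    rw [hξ _ hhalfτ _ hhalf, add_sub_cancel_left, abs_of_pos hτ0]
  obtain ⟨hstr, hwρ⟩ := hball (show ξ (1 / 2) ∈ Metric.ball x ρ' by
    rw [Metric.mem_ball]; linarith)
  have hpw : ∀ i, m / 2 ≤ dist (p i) (ξ (1 / 2)) := by
    intro i
    have := dist_triangle (p i) (ξ (1 / 2)) x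
    have := hm1 i
    linarith
  have hang : ∀ i, ∀ t ∈ Icc (0 : ℝ) 1, τ ≤ |1 / 2 - t| →
      |compAngle (p i) (ξ (1 / 2)) (ξ t) - Real.pi / 2| < δ := by
    intro i t ht hτt
    refine abs_compAngle_sub_lt hS hC hconc hconv hδ hδ1 (ε := m * δ / (8 * D))
      hτ0 hξ hyz (fun s hs => ?_) (hsep i) hhalf ht hτt (hstr.ne i) ?_
    · have h1 := dist_triangle_right (p i) (ξ s) x
      have h2 := hnear s hs
      have h3 := hm2 i
      nlinarith [hs.2]
    · have h1 : 2 * D * (m * δ / (8 * D)) = m * δ / 4 := by field_simp; norm_num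
      have h2 : (S + C + 1) * dist (ξ 0) (ξ 1) / τ ≤ m * δ / 4 := by
        rw [div_le_iff₀ hτ0]
        nlinarith
      have h3 := mul_le_mul_of_nonneg_right (hpw i) hδ.le
      linarith
  refine ⟨ξ (1 / 2), hwρ, Fin.snoc p (ξ 0), isStrainer_snoc (q := ξ (1 / 2 + τ)) hS hC hδ hδ1 hstr
    (by linarith) (fun i => ?_) ⟨?_, ?_, ?_, ?_⟩ (fun i => ⟨hang i 0 (by simp) ?_,
      hang i _ hhalfτ ?_⟩)⟩
  · have h1 := hpw i
    refine arccos_one_sub_lt hδ (by positivity) ?_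
    rw [div_lt_iff₀ (by linarith), hwl]
    nlinarith
  · rw [← dist_pos, hwl]; positivity
  · rw [← dist_pos, hwq]; positivity
  · rw [hξ.compAngle_eq_pi hyz (by norm_num) (by linarith) (by linarith)]
    linarith
  · refine arccos_one_sub_lt hδ (by positivity) ?_
    rw [hwl, hwq, div_lt_iff₀ (by positivity)]
    nlinarith
  · rw [sub_zero, abs_of_pos (by norm_num)]; exact hτ1
  · rw [sub_add_cancel_left, abs_neg, abs_of_pos hτ0]

/-! ### Bi-Lipschitz coordinates and homogeneity of dimension. -/

/-- A strainer that cannot be extended near `x` gives bi-Lipschitz coordinates near `x`. -/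
theorem IsStrainer.exists_isBiLipschitzOn {S C D R δ : ℝ} (hS : 1 ≤ S) (hC : 0 ≤ C)
    (hgeo : IsGeodesicSpace X) (hconc : IsSConcave X S) (hconv : IsLocallySemiConvex X C D)
    (hδ : 0 < δ) (hδ1 : δ ≤ 1) (hR : 0 < R) (hRD : R ≤ D) {k : ℕ} {p : Fin k → X} {x : X}
    (h : IsStrainer S C R δ p x) {U : Set X} (hU : U ∈ 𝓝 x)
    (hempty : ∀ w ∈ U, w ∉ strainedSet X S C R (k + 1) δ) :
    ∃ V : Set X, IsOpen V ∧ x ∈ V ∧ V ⊆ U ∧ (∀ y ∈ V, IsStrainer S C R δ p y) ∧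
      IsBiLipschitzOn (strainerMap p) V := by
  obtain ⟨ρ, hρ, hball⟩ := Metric.mem_nhds_iff.1 hU
  obtain ⟨ε, hε, r, hr, hsep⟩ := h.exists_extension hS hC hgeo hconc hconv hδ hδ1 hR hRD hρ
  refine ⟨Metric.ball x r ∩ Metric.ball x ρ ∩ {y | IsStrainer S C R δ p y},
    (Metric.isOpen_ball.inter Metric.isOpen_ball).inter (isOpen_setOf_isStrainer S C R δ p),
    ⟨⟨Metric.mem_ball_self hr, Metric.mem_ball_self hρ⟩, h⟩, fun y hy => hball hy.1.2,
    fun y hy => hy.2, max (max 1 (1 / ε)) √k, (le_max_left _ _).trans (le_max_left _ _),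
    fun y hy z hz => ⟨?_, ?_⟩⟩
  · have hmax : 1 / ε ≤ max (max 1 (1 / ε)) √k := (le_max_right _ _).trans (le_max_left _ _)
    have hinv : 0 < 1 / ε := by positivity
    rcases eq_or_ne y z with rfl | hyz
    · simp
    · obtain ⟨i, hi⟩ : ∃ i, ε * dist y z < |dist (p i) y - dist (p i) z| := by
        by_contra hc
        push Not at hc
        obtain ⟨w, hw, hw'⟩ := hsep y hy.1.1 z hz.1.1 hyz hc
        exact hempty w (hball hw) hw'
      have h1 : |dist (p i) y - dist (p i) z| ≤ dist (strainerMap p y) (strainerMap p z) := by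
        rw [dist_eq_norm]
        exact PiLp.norm_apply_le (strainerMap p y - strainerMap p z) i
      calc dist y z / max (max 1 (1 / ε)) √k ≤ dist y z / (1 / ε) := by gcongr
        _ = ε * dist y z := by field_simp
        _ ≤ _ := hi.le.trans h1
  · exact (dist_strainerMap_le p y z).trans
      (mul_le_mul_of_nonneg_right (le_max_right _ _) dist_nonneg)

/-- By Busemann concavity, every nonempty open set has the same Hausdorff dimension as the whole
space. -/
theorem dimH_univ_eq_of_isOpen (hgeo : IsGeodesicSpace X) (hBus : IsBusemannConcave X) {V : Set X}
    (hV : IsOpen V) (hne : V.Nonempty) : dimH (univ : Set X) = dimH V := by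
  refine le_antisymm ?_ (dimH_mono (subset_univ _))
  obtain ⟨x, hx⟩ := hne
  obtain ⟨ρ, hρ, hball⟩ := Metric.isOpen_iff.1 hV x hx
  choose γ hγ hγ0 hγ1 using hgeo x
  have huniv : (univ : Set X) = ⋃ m : ℕ, Metric.ball x m := (Metric.iUnion_ball_nat x).symm
  rw [huniv, dimH_iUnion]
  refine iSup_le fun m => ?_
  -- Contraction by `t` towards `x` takes `ball x m` into `V`; `m + 1` keeps the radius positive for
  -- `m = 0`. Busemann concavity prevents distances from shrinking by more than the factor `t`.
  obtain ⟨t, ht, htpos, hle⟩ := exists_mul_le (l := (m : ℝ) + 1) (by positivity) hρ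
  have ht0 : 0 < t := pos_of_mul_pos_left htpos (by positivity)
  have hanti : AntilipschitzWith (1 / t).toNNReal fun y => γ y t := by
    refine AntilipschitzWith.of_le_mul_dist fun y z => ?_
    have h1 := hBus (γ y) (γ z) (hγ y) (hγ z) (by rw [hγ0, hγ0]) ⟨ht0, ht.2⟩
      ⟨one_pos, le_rfl⟩ ht.2
    simp only [hγ1, div_one] at h1
    rw [Real.coe_toNNReal _ (by positivity), one_div_mul_eq_div]
    exact h1
  refine (hanti.le_dimH_image _).trans (dimH_mono ?_)
  rintro _ ⟨y, hy, rfl⟩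
  refine hball ?_
  have h1 := (hγ y).dist_left ht
  rw [hγ0, hγ1, dist_comm] at h1
  rw [Metric.mem_ball, dist_comm] at hy
  rw [Metric.mem_ball, h1]
  nlinarith

theorem IsBiLipschitzOn.dimH_le {Y : Type*} [MetricSpace Y] {f : X → Y} {V : Set X}
    (hf : IsBiLipschitzOn f V) : dimH V ≤ dimH (f '' V) := by
  obtain ⟨L, hL, h⟩ := hf
  have hanti : AntilipschitzWith L.toNNReal fun y : V => f y := by
    refine AntilipschitzWith.of_le_mul_dist fun y z => ?_
    rw [Real.coe_toNNReal _ (by positivity), ← div_le_iff₀' (by positivity)]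
    exact (h y y.2 z z.2).1
  have h1 := hanti.le_dimH_image univ
  have h2 := (isometry_subtype_coe (s := V)).dimH_image univ
  rw [image_univ, Subtype.range_coe] at h2
  rw [h2]
  refine h1.trans (dimH_mono ?_)
  rintro _ ⟨y, -, rfl⟩
  exact mem_image_of_mem _ y.2

theorem IsBiLipschitzOn.injOn {Y : Type*} [MetricSpace Y] {f : X → Y} {V : Set X}
    (hf : IsBiLipschitzOn f V) : InjOn f V := by
  obtain ⟨L, hL, h⟩ := hf
  intro y hy z hz hyz
  have h1 := (h y hy z hz).1
  rw [hyz, dist_self, div_le_iff₀ (by positivity), zero_mul] at h1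
  exact dist_le_zero.1 h1

/-- A maximal strainer determines the Hausdorff dimension. -/
theorem IsStrainer.dimH_eq [CompleteSpace X] {S C D R δ : ℝ} (hS : 1 ≤ S) (hC : 0 ≤ C)
    (hgeo : IsGeodesicSpace X) (hconc : IsSConcave X S) (hconv : IsLocallySemiConvex X C D)
    (hBus : IsBusemannConcave X) (hδ : 0 < δ) (hδ1 : δ ≤ 1 / 16) (hR : 0 < R)
    (hRD : (1 + δ ^ 2) * R ≤ D) {k : ℕ} (hk : δ * 2 ^ (k + 2) ≤ 1) {p : Fin k → X} {x : X}
    (h : IsStrainer S C R δ p x) {U : Set X} (hU : U ∈ 𝓝 x)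
    (hempty : ∀ w ∈ U, w ∉ strainedSet X S C R (k + 1) δ) : dimH (univ : Set X) = k := by
  refine le_antisymm ?_ (h.le_dimH hS hC hgeo hconc hconv hδ hδ1 hRD hk)
  obtain ⟨V, hV, hxV, -, -, hbi⟩ := h.exists_isBiLipschitzOn hS hC hgeo hconc hconv hδ
    (by linarith) hR (by nlinarith [sq_nonneg δ]) hU hempty
  rw [dimH_univ_eq_of_isOpen hgeo hBus hV ⟨x, hxV⟩,
    ← dimH_of_isOpen_euclideanSpace (k := k) isOpen_univ univ_nonempty]
  exact hbi.dimH_le.trans (dimH_mono (subset_univ _))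

/-! ### Strainer number and density. -/

theorem exists_strainerNumberAt_eq [Nonempty X] {S C R : ℝ} {n : ℕ}
    (h : strainerNumber X S C R = n) : ∃ x : X, strainerNumberAt S C R x = n := by
  rw [← h]
  exact ENat.exists_eq_iSup_of_lt_top (by
    rw [← strainerNumber, h]
    exact ENat.natCast_lt_top n)

/-- A finite value rules out the empty infimum `⊤`, and an infimum of a nonempty set in `ℕ∞` is
attained. -/
theorem strainedNear_of_strainerNumberAt_eq {S C R : ℝ} {n : ℕ} {x : X}
    (h : strainerNumberAt S C R x = n) :
    StrainedNear S C R n x ∧ ¬ StrainedNear S C R (n + 1) x := by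
  set T := {m : ℕ | StrainedNear S C R m x ∧ ¬ StrainedNear S C R (m + 1) x} with hT
  have h' : sInf ((fun m : ℕ => (m : ℕ∞)) '' T) = n := by rw [sInf_image]; exact h
  have hne : ((fun m : ℕ => (m : ℕ∞)) '' T).Nonempty := by
    rw [nonempty_iff_ne_empty]
    intro he
    rw [he, sInf_empty] at h'
    exact ENat.natCast_ne_top n h'.symm
  obtain ⟨m, hm, hmn⟩ := csInf_mem hne
  rw [h'] at hmn
  have : m = n := Nat.cast_injective (R := ℕ∞) hmn
  exact this ▸ hm

theorem dimH_univ_eq_of_strainerNumber_eq [CompleteSpace X] {S C D R : ℝ} (hS : 1 ≤ S) (hC : 0 ≤ C)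
    (hgeo : IsGeodesicSpace X) (hconc : IsSConcave X S) (hconv : IsLocallySemiConvex X C D)
    (hBus : IsBusemannConcave X) (hR : 0 < R) (hRD : R < D) {n : ℕ}
    (h : strainerNumber X S C R = n) : dimH (univ : Set X) = n := by
  rcases isEmpty_or_nonempty X with hX | hX
  · have h0 : strainerNumber X S C R = 0 := by simp [strainerNumber]
    rw [h0] at h
    have : n = 0 := by exact_mod_cast h.symm
    rw [univ_eq_empty_iff.2 hX, dimH_empty, this, Nat.cast_zero]
  obtain ⟨x, hx⟩ := exists_strainerNumberAt_eq h
  obtain ⟨h1, h2⟩ := strainedNear_of_strainerNumberAt_eq hx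
  have hsmall : ∀ᶠ δ : ℝ in 𝓝[>] 0,
      0 < δ ∧ δ < 1 / 16 ∧ (1 + δ ^ 2) * R < D ∧ δ * 2 ^ (n + 2) < 1 := by
    refine eventually_mem_nhdsWithin.and (nhdsWithin_le_nhds (Filter.Eventually.and ?_ (.and ?_ ?_)))
    · exact Iio_mem_nhds (by norm_num)
    · exact (Continuous.tendsto' (f := fun δ : ℝ => (1 + δ ^ 2) * R) (by fun_prop) 0 R
        (by simp)).eventually_lt_const hRD
    · exact (Continuous.tendsto' (f := fun δ : ℝ => δ * 2 ^ (n + 2)) (by fun_prop) 0 0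
        (by simp)).eventually_lt_const one_pos
  -- Failure for `n + 1` holds only for frequently many `δ`; intersecting with eventual conditions
  -- yields one common `δ`.
  obtain ⟨δ, hδ, ⟨hδ0, hδ1, hδD, hδn⟩, hnear⟩ :=
    ((Filter.not_eventually.1 h2).and_eventually (hsmall.and h1)).exists
  push Not at hδ
  obtain ⟨U, hU, hempty⟩ := hδ
  obtain ⟨y, hy, p, hp⟩ := hnear (interior U) (interior_mem_nhds.2 hU)
  exact hp.dimH_eq hS hC hgeo hconc hconv hBus hδ0 hδ1.le hR hδD.le hδn.le
    (mem_interior_iff_mem_nhds.1 hy) hempty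

theorem dense_strainedSet [CompleteSpace X] {S C D R δ : ℝ} (hS : 1 ≤ S) (hC : 0 ≤ C)
    (hgeo : IsGeodesicSpace X) (hconc : IsSConcave X S) (hconv : IsLocallySemiConvex X C D)
    (hBus : IsBusemannConcave X) (hR : 0 < R) (hRD : R ≤ D) (hδ : 0 < δ) {n : ℕ}
    (hdim : dimH (univ : Set X) = n) : Dense (strainedSet X S C R n δ) := by
  classical
  rw [dense_iff_inter_open]
  rintro U hU ⟨x, hx⟩
  by_contra hempty
  set δ' : ℝ := min δ (min (1 / 16) (1 / 2 ^ (n + 2))) with hδ'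
  have hδ'0 : 0 < δ' := by positivity
  have hδ'1 : δ' ≤ 1 / 16 := (min_le_right _ _).trans (min_le_left _ _)
  have hδ'n : δ' ≤ 1 / 2 ^ (n + 2) := (min_le_right _ _).trans (min_le_right _ _)
  -- Radius `R / 2` leaves room for the factor `1 + δ'²`, as only `R ≤ D` is known. The least such
  -- `m` makes strainers of length `m - 1` in `U` maximal.
  have hn : ∃ m, ∀ w ∈ U, w ∉ strainedSet X S C (R / 2) m δ' := ⟨n, fun w hw hw' =>
    hempty ⟨w, hw, strainedSet_mono (by linarith) (min_le_left _ _) n hw'⟩⟩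
  have hfind := Nat.find_spec hn
  have hle : Nat.find hn ≤ n := Nat.find_le fun w hw hw' =>
    hempty ⟨w, hw, strainedSet_mono (by linarith) (min_le_left _ _) n hw'⟩
  have hlt := fun m => Nat.find_min hn (m := m)
  generalize Nat.find hn = l at hfind hle hlt
  obtain _ | k := l
  · exact hfind x hx ⟨Fin.elim0, fun h => absurd h (lt_irrefl _), fun j => j.elim0⟩
  · have hk := hlt k (Nat.lt_succ_self k)
    push Not at hk
    obtain ⟨y, hy, p, hp⟩ := hk
    have hpow : δ' * 2 ^ (k + 2) ≤ 1 := by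
      calc δ' * 2 ^ (k + 2) ≤ 1 / 2 ^ (n + 2) * 2 ^ (n + 2) := by
            gcongr
            · norm_num
            · omega
        _ = 1 := by field_simp
    have hsq : δ' ^ 2 ≤ 1 := pow_le_one₀ hδ'0.le (by linarith)
    have := hp.dimH_eq hS hC hgeo hconc hconv hBus hδ'0 hδ'1 (by positivity) (by nlinarith) hpow
      (hU.mem_nhds hy) hfind
    rw [hdim] at this
    have : n = k := by exact_mod_cast this
    omega

/-! ### Charts and the main theorem. -/

/-- A chart of an open set given by an injective, continuous and open map on an open subset. -/
theorem exists_openPartialHomeomorph_of_injOn {Y : Type*} [TopologicalSpace Y] {f : X → Y}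
    {A V : Set X} (hV : IsOpen V) (hA : IsOpen A) (hf : Continuous f) (hinj : InjOn f V)
    (hopen : ∀ W ⊆ V, IsOpen W → IsOpen (f '' W)) (x : A) (hx : (x : X) ∈ V) :
    ∃ e : OpenPartialHomeomorph A Y, x ∈ e.source := by
  have : Nonempty A := ⟨x⟩
  set s : Set A := Subtype.val ⁻¹' V
  have hinj' : InjOn (fun y : A => f y) s := fun y hy z hz hyz => Subtype.ext (hinj hy hz hyz)
  have hs : IsOpen s := hV.preimage continuous_subtype_val
  have ho : IsOpenMap fun y : s => f y := by
    intro W hW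
    have h1 := hopen _ (by rintro _ ⟨y, -, rfl⟩; exact y.2)
      ((hA.isOpenMap_subtype_val.comp hs.isOpenMap_subtype_val) W hW)
    rwa [← image_comp] at h1
  exact ⟨OpenPartialHomeomorph.ofContinuousOpenRestrict (hinj'.toPartialEquiv _ s)
    (hf.comp continuous_subtype_val).continuousOn ho hs, hx⟩

theorem lt_of_lt_strainerConst_div_two {δ : ℝ} (hδ : 0 < δ) {n : ℕ}
    (h : δ < strainerConst (n + 1) / 2) : δ ≤ 1 / 16 ∧ δ * 2 ^ (n + 1 + 2) ≤ 1 := by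
  have hn : (1 : ℝ) ≤ (n + 1 : ℕ) := by exact_mod_cast Nat.succ_pos n
  rw [strainerConst, div_div, lt_div_iff₀ (by positivity)] at h
  have hp : (1 : ℝ) ≤ 2 ^ n := one_le_pow₀ (by norm_num)
  have he : (2 : ℝ) ^ (2 * (n + 1) + 1) * 2 = 16 * (2 ^ n * 2 ^ n) := by ring
  have h1 : δ * (16 * (2 ^ n * 2 ^ n)) ≤ 1 := by
    rw [← he]
    refine le_trans ?_ h.le
    rw [mul_assoc]
    exact mul_le_mul_of_nonneg_left (le_mul_of_one_le_left (by positivity) hn) hδ.le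
  have h2 : (2 : ℝ) ^ n ≤ 2 ^ n * 2 ^ n := le_mul_of_one_le_left (by positivity) hp
  constructor
  · nlinarith
  · rw [show (2 : ℝ) ^ (n + 1 + 2) = 8 * 2 ^ n by ring]
    nlinarith

end BusemannConcave

open BusemannConcave in
theorem mainTheorem2 {X : Type*} [MetricSpace X] [CompleteSpace X]
    [TopologicalSpace.SeparableSpace X] (n : ℕ) (S C D : ℝ)
    (hS : 1 ≤ S) (hC : 0 ≤ C) (hD : 0 < D)
    (hgeo : IsGeodesicSpace X) (hconc : IsSConcave X S) (hconv : IsLocallySemiConvex X C D)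
    (hBus : IsBusemannConcave X)
    (hdim : dimH (Set.univ : Set X) = n ∨
      ∃ R : ℝ, 0 < R ∧ R < D ∧ strainerNumber X S C R = n) :
    (∀ R : ℝ, 0 < R → R ≤ D → ∀ δ : ℝ, 0 < δ →
      IsOpen (strainedSet X S C R n δ) ∧ Dense (strainedSet X S C R n δ)) ∧
    (∀ R : ℝ, 0 < R → ∀ δ : ℝ, 0 < δ → δ < strainerConst (n + 1) / 2 →
      (1 + δ ^ 2) * R ≤ D →
      IsTopologicalManifold n (strainedSet X S C R n δ) ∧
      ∀ (x : X) (p : Fin n → X), IsStrainer S C R δ p x →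
        ∃ V : Set X, IsOpen V ∧ x ∈ V ∧ V ⊆ strainedSet X S C R n δ ∧
          (∀ y ∈ V, IsStrainer S C R δ p y) ∧
          IsOpen (strainerMap p '' V) ∧ IsBiLipschitzOn (strainerMap p) V) := by
  replace hdim : dimH (Set.univ : Set X) = n := by
    rcases hdim with h | ⟨R, hR, hRD, h⟩
    · exact h
    · exact dimH_univ_eq_of_strainerNumber_eq hS hC hgeo hconc hconv hBus hR hRD h
  refine ⟨fun R hR hRD δ hδ => ⟨isOpen_strainedSet S C R n δ,
    dense_strainedSet hS hC hgeo hconc hconv hBus hR hRD hδ hdim⟩, fun R hR δ hδ hδn hRD => ?_⟩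
  obtain ⟨hδ1, hpow⟩ := lt_of_lt_strainerConst_div_two hδ hδn
  have hpow' : δ * 2 ^ (n + 2) ≤ 1 :=
    le_trans (by gcongr <;> norm_num) hpow
  -- The smallness bound for `n + 1` entries excludes longer strainers everywhere, so each
  -- `n`-strainer is maximal.
  have hempty : ∀ w : X, w ∉ strainedSet X S C R (n + 1) δ := by
    rintro w ⟨p, hp⟩
    have h1 := hp.le_dimH hS hC hgeo hconc hconv hδ hδ1 hRD hpow
    rw [hdim] at h1
    have : n + 1 ≤ n := by exact_mod_cast h1
    omega
  have hopen : ∀ (p : Fin n → X) (W : Set X), IsOpen W → (∀ y ∈ W, IsStrainer S C R δ p y) →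
      IsOpen (strainerMap p '' W) := fun p W hW hp =>
    isOpen_image_strainerMap hS hC hgeo hconc hconv hδ hδ1 hRD hpow' hW hp
  have hcharts : ∀ (x : X) (p : Fin n → X), IsStrainer S C R δ p x →
      ∃ V : Set X, IsOpen V ∧ x ∈ V ∧ V ⊆ strainedSet X S C R n δ ∧
        (∀ y ∈ V, IsStrainer S C R δ p y) ∧
        IsOpen (strainerMap p '' V) ∧ IsBiLipschitzOn (strainerMap p) V := by
    intro x p hp
    obtain ⟨V, hV, hxV, -, hpV, hbi⟩ := hp.exists_isBiLipschitzOn hS hC hgeo hconc hconv hδ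
      (by linarith) hR (by nlinarith [sq_nonneg δ]) Filter.univ_mem fun w _ => hempty w
    exact ⟨V, hV, hxV, fun y hy => ⟨p, hpV y hy⟩, hpV, hopen p V hV hpV, hbi⟩
  have : SecondCountableTopology X := UniformSpace.secondCountable_of_separable X
  have hchart : ∀ x : strainedSet X S C R n δ,
      ∃ e : OpenPartialHomeomorph (strainedSet X S C R n δ) (EuclideanSpace ℝ (Fin n)),
        x ∈ e.source := by
    intro x
    obtain ⟨p, hp⟩ := x.2
    obtain ⟨V, hV, hxV, -, hpV, -, hbi⟩ := hcharts x p hp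
    exact exists_openPartialHomeomorph_of_injOn hV (isOpen_strainedSet S C R n δ)
      (lipschitzWith_strainerMap p).continuous hbi.injOn
      (fun W hWV hW => hopen p W hW fun y hy => hpV y (hWV hy)) x hxV
  choose e he using hchart
  exact ⟨⟨inferInstance, inferInstance, ⟨{
    atlas := Set.range e
    chartAt := e
    mem_chart_source := he
    chart_mem_atlas := Set.mem_range_self }⟩⟩, hcharts⟩
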